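/- Consider a single-mode continuous-variable system: a complex Hilbert space $H$ with number basis $(|n\rangle)_{n\ge 0}$ and coherent states $|\alpha\rangle=e^{-|\alpha|^2/2}\sum_{n\ge0}\frac{\alpha^n}{\sqrt{n!}}|n\rangle$, $\alpha\in\mathbb C$. For a density operator $\rho$ let $Q_\rho(\alpha)=\frac1\pi\langle\alpha|\rho|\alpha\rangle$ be its Husimi Q-function; an integrable function $P:\mathbb C\to\mathbb R$ is a (Glauber–Sudarshan) P-function of $\rho$ if $\rho=\int_{\mathbb C}P(\alpha)\,|\alpha\rangle\langle\alpha|\,d^2\alpha$. Write $$d_{\mathrm{kol}}(R_1,R_2)=\tfrac12\int_{\mathbb C}|R_1(\alpha)-R_2(\alpha)|\,d^2\alpha ,\qquad d_{\mathrm{tr}}(\rho,\sigma)=\tfrac12\operatorname{tr}|\rho-\sigma| .$$ Let $\{\Lambda_\tau\}_{\tau\ge0}$ be a family of completely positive trace-preserving linear maps on the trace-class operators of $H$, let $\rho_1,\rho_2$ be density operators, and put $\rho_i(\tau)=\Lambda_\tau[\rho_i]$, $D(\tau)=d_{\mathrm{tr}}(\rho_1(\tau),\rho_2(\tau))$. The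 dynamics is called Markovian if, for every pair of initial states, this trace distance is monotonically decreasing (not necessarily strictly) on $[0,\infty)$, and non-Markovian otherwise. Where $D$ is differentiable let $\sigma(\tau)=D'(\tau)$, and let $$\mathcal N(\rho_1,\rho_2,\{\Lambda_\tau\mid\tau\in[s,t]\})=\int_{\{\tau\in[s,t]\,:\,\sigma(\tau)\ge0\}}\sigma(\tau)\,d\tau\in[0,\infty].$$ Let $0\le s<t$, suppose that $\rho_1(s),\rho_2(s)$ have P-functions $P_1(s),P_2(s)$, and let $Q_i(t)=Q_{\rho_i(t)}$. 1. (Witness) Suppose $d_{\mathrm{kol}}(Q_1(t),Q_2(t))>d_{\mathrm{kol}}(P_1(s),P_2(s))$. Then the trace distance increases at some $\tau\in[s,t]$, i.e. there are arbitrarily short intervals $[a,b]\subseteq[s,t]$ containing $\tau$ with $a<b$ and $D(a)<D(b)$; and the dynamics is non-Markovian. If moreover $D$ is continuous on $[s,t]$ and differentiable at all but at most countably many points of $(s,t)$, then there is $\tau\in[s,t]$ at which $D$ is differentiable with $\sigma(\tau)>0$. 2. (Lower bound) One has $$D(t)-D(s)\ \ge\ d_{\mathrm{kol}}(Q_1(t),Q_2(t))-d_{\mathrm{kol}}(P_1(s),P_2(s))=:\mathcal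 N_{\min},$$ and, if $D$ is continuous on $[s,t]$ and differentiable at all but at most countably many points of $(s,t)$, then $$\mathcal N(\rho_1,\rho_2,\{\Lambda_\tau\mid\tau\in[s,t]\})\ \ge\ D(t)-D(s)\ \ge\ \mathcal N_{\min}.$$ -/

import Mathlib

open scoped ENNReal ComplexOrder
open MeasureTheory Set

namespace CVSystem

noncomputable section

/-! A single-mode continuous-variable system: a complex Hilbert space `H` together with its number
(Fock) basis `e 0, e 1, e 2, …`. -/

/-- The trace `tr A = ∑ₙ ⟨n|A|n⟩`. -/
def trace {H : Type*} [NormedAddCommGroup H] [InnerProductSpace ℂ H]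
    (e : HilbertBasis ℕ ℂ H) (A : H →L[ℂ] H) : ℂ :=
  ∑' n, inner ℂ (e n) (A (e n))

/-- The trace-class operators: the complex linear span of the positive operators of finite trace. -/
def traceClass {H : Type*} [NormedAddCommGroup H] [InnerProductSpace ℂ H]
    (e : HilbertBasis ℕ ℂ H) : Submodule ℂ (H →L[ℂ] H) :=
  Submodule.span ℂ {A | A.IsPositive ∧ Summable fun n => (inner ℂ (e n) (A (e n))).re}

/-- A density operator (quantum state): a positive operator of trace one. -/
def IsDensityOperator {H : Type*} [NormedAddCommGroup H] [InnerProductSpace ℂ H]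
    (e : HilbertBasis ℕ ℂ H) (ρ : traceClass e) : Prop :=
  (ρ : H →L[ℂ] H).IsPositive ∧ trace e ρ = 1

/-- Positivity of a `k × k` block matrix of operators as an operator on `H ⊕ ⋯ ⊕ H`. -/
def BlockPositive {H : Type*} [NormedAddCommGroup H] [InnerProductSpace ℂ H]
    {k : ℕ} (A : Fin k → Fin k → (H →L[ℂ] H)) : Prop :=
  ∀ x : Fin k → H, 0 ≤ ∑ i, ∑ j, inner ℂ (x i) (A i j (x j))

/-- Completely positive trace-preserving maps on the trace-class operators. -/
structure IsCPTP {H : Type*} [NormedAddCommGroup H] [InnerProductSpace ℂ H]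
    (e : HilbertBasis ℕ ℂ H) (Φ : traceClass e →ₗ[ℂ] traceClass e) : Prop where
  completelyPositive : ∀ (k : ℕ) (A : Fin k → Fin k → traceClass e),
    BlockPositive (fun i j => (A i j : H →L[ℂ] H)) →
      BlockPositive (fun i j => (Φ (A i j) : H →L[ℂ] H))
  tracePreserving : ∀ A : traceClass e, trace e (Φ A) = trace e A

/-- The trace distance `½ tr |A - B|`, where `|X| = √(X† X)`. -/
def traceDist {H : Type*} [NormedAddCommGroup H] [InnerProductSpace ℂ H] [CompleteSpace H]
    (e : HilbertBasis ℕ ℂ H) (A B : traceClass e) : ℝ :=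
  1 / 2 * (trace e (CFC.abs ((A : H →L[ℂ] H) - (B : H →L[ℂ] H)))).re

/-- The coherent state `|α⟩ = exp(-|α|²/2) ∑ₙ αⁿ/√(n!) |n⟩`. -/
def coherent {H : Type*} [NormedAddCommGroup H] [InnerProductSpace ℂ H]
    (e : HilbertBasis ℕ ℂ H) (α : ℂ) : H :=
  (Real.exp (-‖α‖ ^ 2 / 2) : ℂ) • ∑' n : ℕ, (α ^ n / (Real.sqrt (n.factorial : ℝ) : ℂ)) • e n

/-- The Husimi Q-function `Q_ρ(α) = (1/π) ⟨α|ρ|α⟩`, a density with respect to `d²α`. -/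
def husimiQ {H : Type*} [NormedAddCommGroup H] [InnerProductSpace ℂ H]
    (e : HilbertBasis ℕ ℂ H) (ρ : traceClass e) (α : ℂ) : ℝ :=
  1 / Real.pi * (inner ℂ (coherent e α) ((ρ : H →L[ℂ] H) (coherent e α))).re

/-- `P` is a Glauber–Sudarshan P-function of `ρ`: an integrable real function on phase space with
`ρ = ∫ P(α) |α⟩⟨α| d²α`. -/
def IsPFunction {H : Type*} [NormedAddCommGroup H] [InnerProductSpace ℂ H]
    (e : HilbertBasis ℕ ℂ H) (ρ : traceClass e) (P : ℂ → ℝ) : Prop :=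
  Integrable P ∧
    (ρ : H →L[ℂ] H) =
      ∫ α : ℂ, (P α : ℂ) • InnerProductSpace.rankOne ℂ (coherent e α) (coherent e α)

/-- The Kolmogorov distance of two (quasi-)probability densities on phase space. -/
def kolDist (R₁ R₂ : ℂ → ℝ) : ℝ :=
  1 / 2 * ∫ α : ℂ, |R₁ α - R₂ α|

/-- The trace distance at time `τ` of two states evolving under the family of maps `Λ`. -/
def evolvedDist {H : Type*} [NormedAddCommGroup H] [InnerProductSpace ℂ H] [CompleteSpace H]
    (e : HilbertBasis ℕ ℂ H) (Λ : ℝ → traceClass e →ₗ[ℂ] traceClass e)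
    (ρ₁ ρ₂ : traceClass e) (τ : ℝ) : ℝ :=
  traceDist e (Λ τ ρ₁) (Λ τ ρ₂)

/-- The dynamics `Λ_τ`, `τ ≥ 0`, is Markovian: the trace distance of every pair of initial states
is monotonically decreasing in time. -/
def IsMarkovian {H : Type*} [NormedAddCommGroup H] [InnerProductSpace ℂ H] [CompleteSpace H]
    (e : HilbertBasis ℕ ℂ H) (Λ : ℝ → traceClass e →ₗ[ℂ] traceClass e) : Prop :=
  ∀ ρ₁ ρ₂ : traceClass e, IsDensityOperator e ρ₁ → IsDensityOperator e ρ₂ →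
    AntitoneOn (evolvedDist e Λ ρ₁ ρ₂) (Ici 0)

/-- The trace-distance non-Markovianity over `[s, t]` of a pair of initial states: the integral of
`σ(τ) = d/dτ d_tr(Λ_τ ρ₁, Λ_τ ρ₂)` over the set of `τ ∈ [s, t]` with `σ(τ) ≥ 0`. -/
def nonMarkovianity {H : Type*} [NormedAddCommGroup H] [InnerProductSpace ℂ H] [CompleteSpace H]
    (e : HilbertBasis ℕ ℂ H) (Λ : ℝ → traceClass e →ₗ[ℂ] traceClass e)
    (ρ₁ ρ₂ : traceClass e) (s t : ℝ) : ℝ≥0∞ :=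
  ∫⁻ τ in {τ | τ ∈ Icc s t ∧ 0 ≤ deriv (evolvedDist e Λ ρ₁ ρ₂) τ},
    ENNReal.ofReal (deriv (evolvedDist e Λ ρ₁ ρ₂) τ)

/-- `f` increases at `τ` within `[s, t]`: there are arbitrarily short intervals
`[a, b] ⊆ [s, t]` containing `τ` with `f a < f b`. -/
def IncreasesAt (f : ℝ → ℝ) (s t τ : ℝ) : Prop :=
  ∀ ε > 0, ∃ a b : ℝ, s ≤ a ∧ a ≤ τ ∧ τ ≤ b ∧ b ≤ t ∧ a < b ∧ b - a < ε ∧ f a < f b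

/-- `f` is continuous on `[s, t]` and differentiable in `(s, t)` up to countably many points. -/
def DifferentiableUpToCountable (f : ℝ → ℝ) (s t : ℝ) : Prop :=
  ContinuousOn f (Icc s t) ∧
    ∃ S : Set ℝ, S.Countable ∧ ∀ τ ∈ Ioo s t \ S, DifferentiableAt ℝ f τ

end

end CVSystem

namespace CVSystem

/-! ### Monotonicity on the real line -/

/-! Everything rests on d_kol(Q₁,Q₂) ≤ d_tr(ρ₁,ρ₂) ≤ d_kol(P₁,P₂): the left inequality is used at
time t, the right one at time s, and subtraction gives the lower bound on D(t) - D(s). Of the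
dynamics only preservation of positivity enters.

Left (`kolDist_husimiQ_le_traceDist`): with X = ρ₁ - ρ₂, |⟨α|X|α⟩| ≤ ⟨α||X||α⟩, and the coherent
states satisfy (1/π)∫⟨α|A|α⟩ ≤ tr A for A ≥ 0. Right (`traceDist_le_kolDist`): X is the integral of
(P₁ - P₂)|α⟩⟨α|, each projector has trace norm one, and the triangle inequality is run through
duality with contractions.

The rest is real analysis on D alone: a net increase localises at a point, and it is at most the
integral of the derivative over the set where this is nonnegative (`ofReal_sub_le_lintegral_deriv`).
-/

theorem exists_increasesAt {f : ℝ → ℝ} {s t : ℝ} (hst : s < t) (hf : f s < f t) :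
    ∃ τ ∈ Icc s t, IncreasesAt f s t τ := by
  by_contra! hcon
  -- If `f` does not increase at c = sup A, the bound by `f s` carries past c, or up to t when c =
  -- t; both are absurd.
  set A : Set ℝ := {x | x ∈ Icc s t ∧ ∀ y ∈ Icc s x, f y ≤ f s} with hA
  have hsA : s ∈ A := by
    refine ⟨⟨le_rfl, hst.le⟩, fun y hy => ?_⟩
    rw [le_antisymm hy.2 hy.1]
  have hbdd : BddAbove A := ⟨t, fun x hx => hx.1.2⟩
  set c := sSup A with hc
  have hsc : s ≤ c := le_csSup hbdd hsA
  have hct : c ≤ t := csSup_le ⟨s, hsA⟩ fun x hx => hx.1.2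
  have hnot := hcon c ⟨hsc, hct⟩
  simp only [IncreasesAt] at hnot
  push Not at hnot
  obtain ⟨ε, hε, h⟩ := hnot
  obtain ⟨x, hxA, hx⟩ := exists_lt_of_lt_csSup ⟨s, hsA⟩ (show c - ε / 2 < sSup A by linarith)
  have hxc : x ≤ c := le_csSup hbdd hxA
  have hfx : f x ≤ f s := hxA.2 x ⟨hxA.1.1, le_rfl⟩
  have key : ∀ y, c ≤ y → y < c + ε / 2 → y ≤ t → f y ≤ f s := by
    intro y hy hy' hyt
    rcases (hxc.trans hy).eq_or_lt with h1 | h1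
    · rwa [← h1]
    · exact (h x y hxA.1.1 hxc hy hyt h1 (by linarith)).trans hfx
  have hbelow : ∀ y ∈ Icc s c, f y ≤ f s := by
    intro y hy
    rcases hy.2.eq_or_lt with h1 | h1
    · rw [h1]; exact key c le_rfl (by linarith) hct
    · obtain ⟨z, hz, hyz⟩ := exists_lt_of_lt_csSup ⟨s, hsA⟩ h1
      exact hz.2 y ⟨hy.1, hyz.le⟩
  rcases hct.eq_or_lt with h1 | h1
  · exact absurd (hbelow t ⟨hst.le, h1.ge⟩) (not_le.2 hf)
  · have hmem : min t (c + ε / 4) ∈ A := by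
      refine ⟨⟨hsc.trans (le_min hct (by linarith)), min_le_left _ _⟩, fun y hy => ?_⟩
      rcases le_total y c with h2 | h2
      · exact hbelow y ⟨hy.1, h2⟩
      · exact key y h2 (by linarith [hy.2.trans (min_le_right _ _)])
          (hy.2.trans (min_le_left _ _))
    have : min t (c + ε / 4) ≤ c := le_csSup hbdd hmem
    rcases min_le_iff.1 this with h2 | h2 <;> linarith

/-- Every level strictly between the values at the endpoints is attained for a last time, and
there the derivative, if it exists, is nonnegative. -/
theorem exists_eq_deriv_nonneg {f : ℝ → ℝ} {s t y : ℝ} (hst : s < t)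
    (hf : ContinuousOn f (Icc s t)) (hs : f s < y) (ht : y < f t) :
    ∃ x ∈ Ioo s t, f x = y ∧ 0 ≤ deriv f x := by
  set A : Set ℝ := Icc s t ∩ f ⁻¹' Iic y with hA
  have hAc : IsCompact A :=
    isCompact_Icc.of_isClosed_subset (hf.preimage_isClosed_of_isClosed isClosed_Icc isClosed_Iic)
      inter_subset_left
  have hne : A.Nonempty := ⟨s, ⟨le_rfl, hst.le⟩, hs.le⟩
  obtain ⟨x, ⟨hx, hxy⟩, hmax⟩ := hAc.exists_isGreatest hne
  have hxt : x < t := lt_of_le_of_ne hx.2 fun h => by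
    rw [h] at hxy; exact absurd hxy (not_le.2 ht)
  have hlt : ∀ z ∈ Ioc x t, y < f z := by
    intro z hz
    by_contra! h
    exact absurd (hmax ⟨⟨hx.1.trans hz.1.le, hz.2⟩, h⟩) (not_le.2 hz.1)
  have hev : ∀ᶠ z in nhdsWithin x (Ioi x), z ∈ Ioc x t := Ioc_mem_nhdsGT hxt
  have hcont : Filter.Tendsto f (nhdsWithin x (Ioi x)) (nhds (f x)) :=
    ((hf x hx).mono_of_mem_nhdsWithin (Filter.mem_of_superset (Ioc_mem_nhdsGT hxt)
      fun z hz => ⟨hx.1.trans hz.1.le, hz.2⟩))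
  have hyx : y ≤ f x := ge_of_tendsto hcont (hev.mono fun z hz => (hlt z hz).le)
  have hfx : f x = y := le_antisymm hxy hyx
  have hsx : s < x := lt_of_le_of_ne hx.1 fun h => by
    rw [← h] at hfx; exact hs.ne hfx
  refine ⟨x, ⟨hsx, hxt⟩, hfx, ?_⟩
  by_cases hd : DifferentiableAt ℝ f x
  · have hs := hasDerivAt_iff_tendsto_slope.1 hd.hasDerivAt
    have hmono : nhdsWithin x (Ioi x) ≤ nhdsWithin x {x}ᶜ :=
      nhdsWithin_mono x fun z hz => (mem_Ioi.1 hz).ne'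
    refine ge_of_tendsto (hs.mono_left hmono) (hev.mono fun z hz => ?_)
    rw [slope_def_field]
    exact div_nonneg (by rw [hfx]; exact sub_nonneg.2 (hlt z hz).le) (sub_nonneg.2 hz.1.le)
  · rw [deriv_zero_of_not_differentiableAt hd]

/-- No integrability of the derivative is needed: every level between `f s` and `f t` is attained at
a point of `E` or of the countable exceptional set, and the measure of `f '' E` is at most the
integral of |f'| over `E`. -/
theorem ofReal_sub_le_lintegral_deriv {f : ℝ → ℝ} {s t : ℝ} (hst : s < t)
    (hf : DifferentiableUpToCountable f s t) :
    ENNReal.ofReal (f t - f s) ≤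
      ∫⁻ τ in {τ | τ ∈ Icc s t ∧ 0 ≤ deriv f τ}, ENNReal.ofReal (deriv f τ) := by
  obtain ⟨hc, S, hS, hd⟩ := hf
  set E : Set ℝ := {x | DifferentiableAt ℝ f x} ∩ (Icc s t ∩ {x | 0 ≤ deriv f x}) with hE
  have hEm : MeasurableSet E := (measurableSet_of_differentiableAt ℝ f).inter
    (measurableSet_Icc.inter (measurableSet_le measurable_const (measurable_deriv f)))
  have hcover : Ioo (f s) (f t) ⊆ f '' E ∪ f '' S := by
    rintro y ⟨hy, hy'⟩
    obtain ⟨x, hx, rfl, hx'⟩ := exists_eq_deriv_nonneg hst hc hy hy'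
    by_cases hxS : x ∈ S
    · exact Or.inr ⟨x, hxS, rfl⟩
    · exact Or.inl ⟨x, ⟨hd x ⟨hx, hxS⟩, Ioo_subset_Icc_self hx, hx'⟩, rfl⟩
  calc ENNReal.ofReal (f t - f s) = volume (Ioo (f s) (f t)) := Real.volume_Ioo.symm
    _ ≤ volume (f '' E) + volume (f '' S) := (measure_mono hcover).trans (measure_union_le _ _)
    _ = volume (f '' E) := by rw [(hS.image f).measure_zero, add_zero]
    _ ≤ ∫⁻ x in E, ENNReal.ofReal |(fderiv ℝ f x).det| :=
        addHaar_image_le_lintegral_abs_det_fderiv volume hEm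
          fun x hx => hx.1.hasFDerivAt.hasFDerivWithinAt
    _ = ∫⁻ x in E, ENNReal.ofReal (deriv f x) := by
        refine setLIntegral_congr_fun hEm fun x hx => ?_
        have h : (fderiv ℝ f x).det = deriv f x := by
          rw [← toSpanSingleton_deriv, ContinuousLinearMap.det_toSpanSingleton]
        have h0 : 0 ≤ deriv f x := hx.2.2
        simp only [h, abs_of_nonneg h0]
    _ ≤ _ := lintegral_mono_set inter_subset_right

theorem exists_deriv_pos {f : ℝ → ℝ} {s t : ℝ} (hst : s < t)
    (hf : DifferentiableUpToCountable f s t) (hlt : f s < f t) :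
    ∃ τ ∈ Icc s t, DifferentiableAt ℝ f τ ∧ 0 < deriv f τ := by
  by_contra! hcon
  have hle : ∀ τ ∈ Icc s t, deriv f τ ≤ 0 := by
    intro τ hτ
    by_cases hd : DifferentiableAt ℝ f τ
    · exact hcon τ hτ hd
    · rw [deriv_zero_of_not_differentiableAt hd]
  have h := ofReal_sub_le_lintegral_deriv hst hf
  have hm : MeasurableSet {τ | τ ∈ Icc s t ∧ 0 ≤ deriv f τ} :=
    measurableSet_Icc.inter (measurableSet_le measurable_const (measurable_deriv f))
  rw [setLIntegral_congr_fun (g := fun _ => 0) hm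
    fun x hx => ENNReal.ofReal_of_nonpos (hle x hx.1)] at h
  simp only [lintegral_zero, nonpos_iff_eq_zero, ENNReal.ofReal_eq_zero] at h
  linarith

end CVSystem

namespace CVSystem

/-! ### Gaussian moments on the complex plane -/

theorem gaussianMoment_eq (n : ℕ) :
    ∫ α : ℂ, ‖α‖ ^ n * Real.exp (-‖α‖ ^ 2) = Real.pi * Real.Gamma ((n + 2) / 2) := by
  have h := Complex.integral_rpow_mul_exp_neg_rpow (p := 2) (q := n) (by norm_num)
    (by have : (0 : ℝ) ≤ n := n.cast_nonneg
        linarith)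
  simp only [Real.rpow_natCast, Real.rpow_two] at h
  rw [h]
  ring

/-- A non-integrable function has Bochner integral 0, whereas this integral is known to be positive.
-/
theorem integrable_gaussianMoment (n : ℕ) :
    Integrable fun α : ℂ => ‖α‖ ^ n * Real.exp (-‖α‖ ^ 2) := by
  by_contra h
  have h0 := integral_undef h
  rw [gaussianMoment_eq] at h0
  have : 0 < Real.pi * Real.Gamma ((n + 2) / 2) :=
    mul_pos Real.pi_pos (Real.Gamma_pos_of_pos (by positivity))
  exact this.ne' h0

theorem gaussianMoment_even (n : ℕ) :
    ∫ α : ℂ, ‖α‖ ^ (2 * n) * Real.exp (-‖α‖ ^ 2) = Real.pi * n.factorial := by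
  rw [gaussianMoment_eq, ← Real.Gamma_nat_eq_factorial]
  congr 2
  push_cast
  ring

theorem integrable_monomial (m n : ℕ) :
    Integrable fun α : ℂ => star α ^ m * α ^ n * (Real.exp (-‖α‖ ^ 2) : ℂ) := by
  refine (integrable_gaussianMoment (m + n)).mono' (by fun_prop) (ae_of_all _ fun α => ?_)
  rw [norm_mul, norm_mul, norm_pow, norm_pow, norm_star, Complex.norm_real, Real.norm_eq_abs,
    Real.abs_exp, pow_add]

theorem integral_monomial_of_ne {m n : ℕ} (hmn : m ≠ n) :
    ∫ α : ℂ, star α ^ m * α ^ n * (Real.exp (-‖α‖ ^ 2) : ℂ) = 0 := by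
  -- Rotation by θ preserves Lebesgue measure and multiplies the integrand by exp(i(n - m)θ) = -1,
  -- so the integral equals its own negative.
  set θ : ℝ := Real.pi / ((n : ℝ) - m) with hθ
  have hne : (n : ℝ) - m ≠ 0 := sub_ne_zero.2 (by exact_mod_cast hmn.symm)
  have hrot := (rotation (Circle.exp θ)).measurePreserving.integral_comp
    (rotation (Circle.exp θ)).toHomeomorph.measurableEmbedding
    (fun α : ℂ => star α ^ m * α ^ n * (Real.exp (-‖α‖ ^ 2) : ℂ))
  have hphase : star (Circle.exp θ : ℂ) ^ m * (Circle.exp θ : ℂ) ^ n = -1 := by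
    rw [Circle.coe_exp, ← starRingEnd_apply, ← Complex.exp_conj, ← Complex.exp_nat_mul,
      ← Complex.exp_nat_mul, ← Complex.exp_add, ← Complex.exp_pi_mul_I]
    congr 1
    have : (θ : ℂ) * ((n : ℂ) - m) = Real.pi := by
      rw [hθ]; push_cast
      exact div_mul_cancel₀ _ (by exact_mod_cast hne)
    simp only [map_mul, Complex.conj_ofReal, Complex.conj_I]
    linear_combination Complex.I * this
  have hfun : ∀ α : ℂ, star (rotation (Circle.exp θ) α) ^ m * (rotation (Circle.exp θ) α) ^ n *
      (Real.exp (-‖rotation (Circle.exp θ) α‖ ^ 2) : ℂ) =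
      -(star α ^ m * α ^ n * (Real.exp (-‖α‖ ^ 2) : ℂ)) := by
    intro α
    rw [LinearIsometryEquiv.norm_map, rotation_apply, star_mul', mul_pow, mul_pow]
    linear_combination (star α ^ m * α ^ n * (Real.exp (-‖α‖ ^ 2) : ℂ)) * hphase
  simp only [hfun, integral_neg] at hrot
  linear_combination (-1 / 2 : ℂ) * hrot

theorem integral_monomial_self (n : ℕ) :
    ∫ α : ℂ, star α ^ n * α ^ n * (Real.exp (-‖α‖ ^ 2) : ℂ) = (Real.pi * n.factorial : ℝ) := by
  rw [← gaussianMoment_even, ← integral_complex_ofReal]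
  congr 1
  ext α
  rw [← mul_pow, ← starRingEnd_apply, Complex.conj_mul', pow_mul]
  push_cast
  rfl

theorem ofReal_polynomial_sq_eq (c : ℕ → ℂ) (N : ℕ) (α : ℂ) :
    ((‖∑ n ∈ Finset.range N, c n * α ^ n‖ ^ 2 * Real.exp (-‖α‖ ^ 2) : ℝ) : ℂ) =
      ∑ m ∈ Finset.range N, ∑ n ∈ Finset.range N,
        star (c m) * c n * (star α ^ m * α ^ n * (Real.exp (-‖α‖ ^ 2) : ℂ)) := by
  rw [Complex.ofReal_mul, Complex.ofReal_pow, ← Complex.conj_mul', starRingEnd_apply, star_sum,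
    Finset.sum_mul_sum, Finset.sum_mul]
  refine Finset.sum_congr rfl fun m _ => ?_
  rw [Finset.sum_mul]
  refine Finset.sum_congr rfl fun n _ => ?_
  rw [star_mul', star_pow]
  ring

theorem integrable_polynomial_sq (c : ℕ → ℂ) (N : ℕ) :
    Integrable fun α : ℂ => ‖∑ n ∈ Finset.range N, c n * α ^ n‖ ^ 2 * Real.exp (-‖α‖ ^ 2) := by
  have h : Integrable fun α : ℂ =>
      ((‖∑ n ∈ Finset.range N, c n * α ^ n‖ ^ 2 * Real.exp (-‖α‖ ^ 2) : ℝ) : ℂ) := by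
    simp only [ofReal_polynomial_sq_eq]
    exact integrable_finsetSum _ fun m _ => integrable_finsetSum _ fun n _ =>
      (integrable_monomial m n).const_mul _
  exact h.re

theorem integral_polynomial_sq (c : ℕ → ℂ) (N : ℕ) :
    ∫ α : ℂ, ‖∑ n ∈ Finset.range N, c n * α ^ n‖ ^ 2 * Real.exp (-‖α‖ ^ 2) =
      Real.pi * ∑ n ∈ Finset.range N, ‖c n‖ ^ 2 * n.factorial := by
  have hint : ∀ m n, Integrable fun α : ℂ =>
      star (c m) * c n * (star α ^ m * α ^ n * (Real.exp (-‖α‖ ^ 2) : ℂ)) :=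
    fun m n => (integrable_monomial m n).const_mul _
  apply Complex.ofReal_injective
  rw [← integral_complex_ofReal]
  simp only [ofReal_polynomial_sq_eq]
  rw [integral_finsetSum _ fun m _ => integrable_finsetSum _ fun n _ => hint m n]
  rw [Finset.mul_sum, Complex.ofReal_sum]
  refine Finset.sum_congr rfl fun m hm => ?_
  rw [integral_finsetSum _ fun n _ => hint m n, Finset.sum_eq_single_of_mem m hm]
  · rw [integral_const_mul, integral_monomial_self, ← starRingEnd_apply, Complex.conj_mul']
    push_cast
    ring
  · intro n _ hn
    rw [integral_const_mul, integral_monomial_of_ne hn.symm, mul_zero]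

/-! ### Coherent states -/

section Coherent

variable {H : Type*} [NormedAddCommGroup H] [InnerProductSpace ℂ H] (e : HilbertBasis ℕ ℂ H)

theorem norm_coherentCoeff_sq (α : ℂ) (n : ℕ) :
    ‖α ^ n / (Real.sqrt (n.factorial : ℝ) : ℂ)‖ ^ 2 = (‖α‖ ^ 2) ^ n / n.factorial := by
  rw [norm_div, norm_pow, Complex.norm_real, Real.norm_eq_abs, abs_of_nonneg (Real.sqrt_nonneg _),
    div_pow, Real.sq_sqrt (by positivity), ← pow_mul, ← pow_mul, mul_comm]

/-- The coefficients are square-summable, so the `tsum` in `coherent` is a genuine sum and not the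
default 0. -/
theorem exists_coherent_series (α : ℂ) :
    ∃ v : H, HasSum (fun n : ℕ => (α ^ n / (Real.sqrt (n.factorial : ℝ) : ℂ)) • e n) v ∧
      ‖v‖ ^ 2 = Real.exp (‖α‖ ^ 2) := by
  have hsum : HasSum (fun n : ℕ => ‖α ^ n / (Real.sqrt (n.factorial : ℝ) : ℂ)‖ ^ 2)
      (Real.exp (‖α‖ ^ 2)) := by
    simp only [norm_coherentCoeff_sq]
    rw [Real.exp_eq_exp_ℝ]
    exact NormedSpace.expSeries_div_hasSum_exp (‖α‖ ^ 2)
  have hmem : Memℓp (fun n : ℕ => α ^ n / (Real.sqrt (n.factorial : ℝ) : ℂ)) 2 := by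
    refine memℓp_gen ?_
    simpa using hsum.summable
  refine ⟨e.repr.symm ⟨_, hmem⟩, e.hasSum_repr_symm ⟨_, hmem⟩, ?_⟩
  rw [LinearIsometryEquiv.norm_map]
  have h := lp.norm_rpow_eq_tsum (p := 2) (by norm_num) (⟨_, hmem⟩ : lp (fun _ : ℕ => ℂ) 2)
  simp only [ENNReal.toReal_ofNat, Real.rpow_two] at h
  rw [h]
  exact hsum.tsum_eq

theorem hasSum_coherent (α : ℂ) :
    HasSum (fun n : ℕ => (Real.exp (-‖α‖ ^ 2 / 2) : ℂ) •
      (α ^ n / (Real.sqrt (n.factorial : ℝ) : ℂ)) • e n) (coherent e α) := by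
  obtain ⟨v, hv, -⟩ := exists_coherent_series e α
  rw [coherent, hv.tsum_eq]
  exact hv.const_smul _

theorem norm_coherent (α : ℂ) : ‖coherent e α‖ = 1 := by
  obtain ⟨v, hv, hn⟩ := exists_coherent_series e α
  rw [← sq_eq_sq₀ (norm_nonneg _) zero_le_one, coherent, hv.tsum_eq, norm_smul, mul_pow, hn,
    Complex.norm_real, Real.norm_eq_abs, Real.abs_exp, ← Real.exp_nat_mul, ← Real.exp_add]
  simp only [one_pow, Real.exp_eq_one_iff]
  push_cast
  ring

theorem tendsto_coherent (α : ℂ) :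
    Filter.Tendsto (fun N => ∑ n ∈ Finset.range N, (Real.exp (-‖α‖ ^ 2 / 2) : ℂ) •
      (α ^ n / (Real.sqrt (n.factorial : ℝ) : ℂ)) • e n) Filter.atTop (nhds (coherent e α)) :=
  (hasSum_coherent e α).tendsto_sum_nat

theorem stronglyMeasurable_coherent : StronglyMeasurable (coherent e) := by
  refine stronglyMeasurable_of_tendsto Filter.atTop (fun N => ?_)
    (tendsto_pi_nhds.2 (tendsto_coherent e))
  exact Continuous.stronglyMeasurable (by fun_prop)

/-- The half of the resolution of identity ∫|α⟩⟨α| = π·1 that is needed. Truncated to N terms, the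
overlap is a polynomial times a Gaussian; orthogonality of monomials and Bessel bound its integral,
and Fatou passes to the limit. -/
theorem lintegral_norm_inner_coherent_sq_le (v : H) :
    ∫⁻ α : ℂ, ENNReal.ofReal (‖inner ℂ v (coherent e α)‖ ^ 2) ≤
      ENNReal.ofReal (Real.pi * ‖v‖ ^ 2) := by
  set c : ℕ → ℂ := fun n => inner ℂ v (e n) / (Real.sqrt (n.factorial : ℝ) : ℂ) with hc
  have hpart : ∀ (N : ℕ) (α : ℂ), ‖inner ℂ v (∑ n ∈ Finset.range N,
      (Real.exp (-‖α‖ ^ 2 / 2) : ℂ) • (α ^ n / (Real.sqrt (n.factorial : ℝ) : ℂ)) • e n)‖ ^ 2 =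
      ‖∑ n ∈ Finset.range N, c n * α ^ n‖ ^ 2 * Real.exp (-‖α‖ ^ 2) := by
    intro N α
    have h1 : inner ℂ v (∑ n ∈ Finset.range N,
        (Real.exp (-‖α‖ ^ 2 / 2) : ℂ) • (α ^ n / (Real.sqrt (n.factorial : ℝ) : ℂ)) • e n) =
        (Real.exp (-‖α‖ ^ 2 / 2) : ℂ) * ∑ n ∈ Finset.range N, c n * α ^ n := by
      rw [inner_sum, Finset.mul_sum]
      refine Finset.sum_congr rfl fun n _ => ?_
      rw [inner_smul_right, inner_smul_right]
      simp only [hc]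
      ring
    rw [h1, norm_mul, mul_pow, Complex.norm_real, Real.norm_eq_abs, Real.abs_exp,
      ← Real.exp_nat_mul, mul_comm]
    congr 2
    push_cast
    ring
  have hlim : ∀ α : ℂ, ENNReal.ofReal (‖inner ℂ v (coherent e α)‖ ^ 2) =
      Filter.liminf (fun N => ENNReal.ofReal
        (‖∑ n ∈ Finset.range N, c n * α ^ n‖ ^ 2 * Real.exp (-‖α‖ ^ 2))) Filter.atTop := by
    intro α
    refine (Filter.Tendsto.liminf_eq (ENNReal.tendsto_ofReal ?_)).symm
    simp only [← hpart]
    exact ((tendsto_const_nhds.inner (tendsto_coherent e α)).norm).pow 2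
  simp only [hlim]
  refine (lintegral_liminf_le fun N => by fun_prop).trans ?_
  refine Filter.liminf_le_of_le (by isBoundedDefault) fun b hb => ?_
  obtain ⟨N, hN⟩ := hb.exists
  refine hN.trans ?_
  rw [← ofReal_integral_eq_lintegral_ofReal (integrable_polynomial_sq c N)
    (ae_of_all _ fun α => by positivity), integral_polynomial_sq]
  refine ENNReal.ofReal_le_ofReal (mul_le_mul_of_nonneg_left ?_ Real.pi_pos.le)
  refine le_trans (le_of_eq ?_) (e.orthonormal.sum_inner_products_le v (s := Finset.range N))
  refine Finset.sum_congr rfl fun n _ => ?_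
  simp only [hc]
  rw [norm_div, Complex.norm_real, Real.norm_eq_abs, abs_of_nonneg (Real.sqrt_nonneg _), div_pow,
    Real.sq_sqrt (by positivity), div_mul_cancel₀ _ (by positivity), norm_inner_symm]

end Coherent

end CVSystem

namespace CVSystem

/-! ### Hilbert–Schmidt sums and the trace norm -/

section Operators

variable {H : Type*} [NormedAddCommGroup H] [InnerProductSpace ℂ H] (e : HilbertBasis ℕ ℂ H)

theorem tsum_ofReal_norm_inner_sq (x : H) :
    ∑' n, ENNReal.ofReal (‖inner ℂ (e n) x‖ ^ 2) = ENNReal.ofReal (‖x‖ ^ 2) := by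
  have h := (Complex.hasSum_re (e.hasSum_inner_mul_inner x x))
  have heq : ∀ n, (inner ℂ x (e n) * inner ℂ (e n) x).re = ‖inner ℂ (e n) x‖ ^ 2 := by
    intro n
    rw [← inner_conj_symm, Complex.conj_mul']
    norm_cast
  simp only [heq] at h
  rw [← ENNReal.ofReal_tsum_of_nonneg (fun n => by positivity) h.summable, h.tsum_eq,
    norm_sq_eq_re_inner (𝕜 := ℂ) x]
  rfl

theorem abs_re_inner_le (x y : H) : |(inner ℂ x y).re| ≤ (‖x‖ ^ 2 + ‖y‖ ^ 2) / 2 := by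
  have h := (Complex.abs_re_le_norm _).trans (norm_inner_le_norm (𝕜 := ℂ) x y)
  nlinarith [sq_nonneg (‖x‖ - ‖y‖)]

/-- Each diagonal entry is p⟨v|eₙ⟩⟨eₙ|Uv⟩; apply AM-GM, then Bessel to `v` and to `U v`. -/
theorem sum_re_inner_mul_rankOne_le {U : H →L[ℂ] H} (hU : ‖U‖ ≤ 1) {v : H} (hv : ‖v‖ = 1) (p : ℝ)
    (N : ℕ) :
    ∑ n ∈ Finset.range N,
      (inner ℂ (e n) ((U * ((p : ℂ) • InnerProductSpace.rankOne ℂ v v)) (e n))).re ≤ |p| := by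
  have hterm : ∀ n, (inner ℂ (e n) ((U * ((p : ℂ) • InnerProductSpace.rankOne ℂ v v)) (e n))).re ≤
      |p| * ((‖inner ℂ (e n) v‖ ^ 2 + ‖inner ℂ (e n) (U v)‖ ^ 2) / 2) := by
    intro n
    have h1 : inner ℂ (e n) ((U * ((p : ℂ) • InnerProductSpace.rankOne ℂ v v)) (e n)) =
        (p : ℂ) * (inner ℂ v (e n) * inner ℂ (e n) (U v)) := by
      rw [mul_apply_eq_comp, smul_apply,
        InnerProductSpace.rankOne_apply, map_smul, map_smul, inner_smul_right, inner_smul_right]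
    rw [h1]
    refine (Complex.re_le_norm _).trans ?_
    rw [norm_mul, norm_mul, Complex.norm_real, Real.norm_eq_abs, norm_inner_symm v]
    refine mul_le_mul_of_nonneg_left ?_ (abs_nonneg _)
    nlinarith [sq_nonneg (‖inner ℂ (e n) v‖ - ‖inner ℂ (e n) (U v)‖)]
  refine (Finset.sum_le_sum fun n _ => hterm n).trans ?_
  rw [← Finset.mul_sum, ← Finset.sum_div, Finset.sum_add_distrib]
  have h1 := e.orthonormal.sum_inner_products_le v (s := Finset.range N)
  have h2 := e.orthonormal.sum_inner_products_le (U v) (s := Finset.range N)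
  have h3 : ‖U v‖ ^ 2 ≤ 1 := by
    refine pow_le_one₀ (norm_nonneg _) ((U.le_opNorm v).trans ?_)
    rwa [hv, mul_one]
  rw [hv, one_pow] at h1
  exact mul_le_of_le_one_right (abs_nonneg _) (by linarith)

theorem IsCPTP.isPositive {Φ : traceClass e →ₗ[ℂ] traceClass e} (hΦ : IsCPTP e Φ)
    {A : traceClass e} (hA : (A : H →L[ℂ] H).IsPositive) : (Φ A : H →L[ℂ] H).IsPositive := by
  -- Positivity is the case of 1 × 1 blocks.
  have h := hΦ.completelyPositive 1 (fun _ _ => A) fun x => by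
    simpa using hA.inner_nonneg_right (x 0)
  rw [ContinuousLinearMap.isPositive_iff_complex]
  intro x
  have hx : 0 ≤ inner ℂ x ((Φ A : H →L[ℂ] H) x) := by simpa using h fun _ => x
  obtain ⟨hre, him⟩ := Complex.nonneg_iff.1 hx
  rw [← inner_conj_symm, Complex.conj_eq_iff_im.2 him.symm]
  exact ⟨Complex.ext (by simp) (by simp [← him]), hre⟩

variable [CompleteSpace H]

/-- Both sides are the double sum of |⟨eₘ|C eₙ⟩|² by Parseval; in [0,∞] the order of summation is
free. -/
theorem tsum_ofReal_norm_sq_adjoint (C : H →L[ℂ] H) :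
    ∑' n, ENNReal.ofReal (‖C (e n)‖ ^ 2) = ∑' n, ENNReal.ofReal (‖star C (e n)‖ ^ 2) := by
  simp only [← tsum_ofReal_norm_inner_sq e (C _), ← tsum_ofReal_norm_inner_sq e (star C _)]
  rw [ENNReal.tsum_comm]
  refine tsum_congr fun m => tsum_congr fun n => ?_
  rw [ContinuousLinearMap.star_eq_adjoint, ContinuousLinearMap.adjoint_inner_right,
    norm_inner_symm]

theorem exists_star_mul_self {A : H →L[ℂ] H} (hA : A.IsPositive) :
    ∃ B : H →L[ℂ] H, A = star B * B :=
  CStarAlgebra.nonneg_iff_eq_star_mul_self.1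
    ((ContinuousLinearMap.nonneg_iff_isPositive A).2 hA)

theorem inner_star_mul (B C : H →L[ℂ] H) (x y : H) :
    inner ℂ x ((star B * C) y) = inner ℂ (B x) (C y) := by
  rw [mul_apply_eq_comp, ContinuousLinearMap.star_eq_adjoint,
    ContinuousLinearMap.adjoint_inner_right]

theorem re_inner_star_mul_self (B : H →L[ℂ] H) (x : H) :
    (inner ℂ x ((star B * B) x)).re = ‖B x‖ ^ 2 := by
  rw [inner_star_mul, norm_sq_eq_re_inner (𝕜 := ℂ)]
  rfl

/-- The phase-space integral of the expectation values of a positive operator in the coherent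
states is at most `π` times its trace. -/
theorem lintegral_re_inner_coherent_le {A : H →L[ℂ] H} (hA : A.IsPositive) :
    ∫⁻ α : ℂ, ENNReal.ofReal (inner ℂ (coherent e α) (A (coherent e α))).re ≤
      ENNReal.ofReal Real.pi * ∑' n, ENNReal.ofReal (inner ℂ (e n) (A (e n))).re := by
  obtain ⟨B, rfl⟩ := exists_star_mul_self hA
  simp only [re_inner_star_mul_self]
  -- With A = B†B, Parseval reduces the integrand to overlaps of coherent states with B†eₙ; the
  -- resulting Hilbert–Schmidt sum of B† equals that of B, which is the trace of A.
  have hexp : ∀ α, ENNReal.ofReal (‖B (coherent e α)‖ ^ 2) =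
      ∑' n, ENNReal.ofReal (‖inner ℂ (star B (e n)) (coherent e α)‖ ^ 2) := by
    intro α
    simp only [← tsum_ofReal_norm_inner_sq e (B _), ContinuousLinearMap.star_eq_adjoint,
      ContinuousLinearMap.adjoint_inner_left]
  simp only [hexp]
  rw [lintegral_tsum fun n => by
    have := ((stronglyMeasurable_const (b := star B (e n))).inner (𝕜 := ℂ)
      (stronglyMeasurable_coherent e)).norm.measurable
    exact (this.pow_const 2).ennreal_ofReal.aemeasurable, tsum_ofReal_norm_sq_adjoint,
    ← ENNReal.tsum_mul_left]
  refine ENNReal.tsum_le_tsum fun n => ?_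
  rw [← ENNReal.ofReal_mul Real.pi_pos.le]
  exact lintegral_norm_inner_coherent_sq_le e _

/-- A contraction `U` with `U X` close to `|X|`, a regularised sign of `X`. -/
theorem exists_contraction_near_abs {X : H →L[ℂ] H} (hX : IsSelfAdjoint X) {ε : ℝ} (hε : 0 < ε) :
    ∃ U : H →L[ℂ] H, ‖U‖ ≤ 1 ∧ ‖CFC.abs X - U * X‖ ≤ ε := by
  have hpos : ∀ x : ℝ, 0 < |x| + ε := fun x => by positivity
  have hcont : Continuous fun x : ℝ => x / (|x| + ε) :=
    continuous_id.div (by fun_prop) fun x => (hpos x).ne'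
  -- x/(|x| + ε) is a continuous substitute for sign x; the error |x| - x²/(|x| + ε) = |x|ε/(|x| +
  -- ε) is at most ε.
  refine ⟨cfc (fun x : ℝ => x / (|x| + ε)) X, norm_cfc_le zero_le_one fun x _ => ?_, ?_⟩
  · rw [norm_div, Real.norm_eq_abs, Real.norm_eq_abs, abs_of_pos (hpos x), div_le_one (hpos x)]
    linarith
  · have hUX : cfc (fun x : ℝ => x / (|x| + ε)) X * X =
        cfc (fun x : ℝ => x / (|x| + ε) * x) X := by
      conv_lhs => rw [← cfc_id' ℝ X hX, cfc_id' ℝ X hX]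
      nth_rewrite 2 [← cfc_id' ℝ X hX]
      exact (cfc_mul _ _ X hcont.continuousOn (by fun_prop)).symm
    rw [CFC.abs_eq_cfc_norm X hX, hUX,
      ← cfc_sub (fun x : ℝ => ‖x‖) (fun x => x / (|x| + ε) * x) X (by fun_prop)
        (hcont.mul continuous_id).continuousOn]
    refine norm_cfc_le hε.le fun x _ => ?_
    have hx : ‖x‖ - x / (|x| + ε) * x = |x| * ε / (|x| + ε) := by
      rw [Real.norm_eq_abs, eq_div_iff (hpos x).ne', sub_mul, div_mul_eq_mul_div,
        div_mul_cancel₀ _ (hpos x).ne', ← abs_mul_abs_self x]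
      ring
    rw [hx, Real.norm_eq_abs, abs_of_nonneg (by positivity), div_le_iff₀ (hpos x)]
    nlinarith [abs_nonneg x]

theorem re_inner_nonneg {A : H →L[ℂ] H} (hA : A.IsPositive) (x : H) :
    0 ≤ (inner ℂ x (A x)).re := by
  obtain ⟨B, rfl⟩ := exists_star_mul_self hA
  rw [re_inner_star_mul_self]
  positivity

theorem im_inner_eq_zero {A : H →L[ℂ] H} (hA : A.IsPositive) (x : H) :
    (inner ℂ x (A x)).im = 0 := by
  obtain ⟨B, rfl⟩ := exists_star_mul_self hA
  rw [inner_star_mul]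
  exact inner_self_im (𝕜 := ℂ) (B x)

theorem isPositive_abs (X : H →L[ℂ] H) : (CFC.abs X).IsPositive :=
  (ContinuousLinearMap.nonneg_iff_isPositive _).1 (CFC.abs_nonneg X)

theorem re_trace_of_isPositive {A : H →L[ℂ] H} (hA : A.IsPositive) :
    (trace e A).re = ∑' n, (inner ℂ (e n) (A (e n))).re := by
  have h : ∀ n, inner ℂ (e n) (A (e n)) = (((inner ℂ (e n) (A (e n))).re : ℝ) : ℂ) := fun n =>
    Complex.ext (by simp) (by simp [im_inner_eq_zero hA])
  rw [trace]
  conv_lhs => enter [1, 1, n]; rw [h n]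
  rw [← Complex.ofReal_tsum, Complex.ofReal_re]

/-- Trace duality: the trace norm of `X` is bounded by a common bound on the partial traces of
`U X` over all contractions `U`. -/
theorem sum_abs_le_of_contractions {X : H →L[ℂ] H} (hX : IsSelfAdjoint X) {K : ℝ}
    (hK : ∀ U : H →L[ℂ] H, ‖U‖ ≤ 1 → ∀ N,
      ∑ n ∈ Finset.range N, (inner ℂ (e n) ((U * X) (e n))).re ≤ K) (N : ℕ) :
    ∑ n ∈ Finset.range N, (inner ℂ (e n) (CFC.abs X (e n))).re ≤ K := by
  refine le_of_forall_pos_le_add fun δ hδ => ?_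
  have hN : (0 : ℝ) < N + 1 := by positivity
  -- The N diagonal entries together lose at most N·δ/(N + 1) ≤ δ; the +1 covers N = 0.
  obtain ⟨U, hU, hUX⟩ := exists_contraction_near_abs hX (div_pos hδ hN)
  have hterm : ∀ n, (inner ℂ (e n) (CFC.abs X (e n))).re ≤
      (inner ℂ (e n) ((U * X) (e n))).re + δ / (N + 1) := by
    intro n
    have h1 : (inner ℂ (e n) ((CFC.abs X - U * X) (e n))).re ≤ δ / (N + 1) := by
      refine (Complex.re_le_norm _).trans ((norm_inner_le_norm _ _).trans ?_)
      rw [e.orthonormal.norm_eq_one, one_mul]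
      refine (ContinuousLinearMap.le_opNorm _ _).trans ?_
      rwa [e.orthonormal.norm_eq_one, mul_one]
    rw [sub_apply, inner_sub_right, Complex.sub_re] at h1
    linarith
  refine (Finset.sum_le_sum fun n _ => hterm n).trans ?_
  rw [Finset.sum_add_distrib, Finset.sum_const, Finset.card_range, nsmul_eq_mul]
  refine add_le_add (hK U hU N) ?_
  rw [mul_div_assoc', div_le_iff₀ hN]
  nlinarith

theorem summable_abs_of_contractions {X : H →L[ℂ] H} (hX : IsSelfAdjoint X) {K : ℝ}
    (hK : ∀ U : H →L[ℂ] H, ‖U‖ ≤ 1 → ∀ N,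
      ∑ n ∈ Finset.range N, (inner ℂ (e n) ((U * X) (e n))).re ≤ K) :
    Summable fun n => (inner ℂ (e n) (CFC.abs X (e n))).re :=
  summable_of_sum_range_le (fun _ => re_inner_nonneg (isPositive_abs X) _)
    (sum_abs_le_of_contractions e hX hK)

theorem re_trace_abs_le_of_contractions {X : H →L[ℂ] H} (hX : IsSelfAdjoint X) {K : ℝ}
    (hK : ∀ U : H →L[ℂ] H, ‖U‖ ≤ 1 → ∀ N,
      ∑ n ∈ Finset.range N, (inner ℂ (e n) ((U * X) (e n))).re ≤ K) :
    (trace e (CFC.abs X)).re ≤ K := by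
  rw [re_trace_of_isPositive e (isPositive_abs X)]
  exact Real.tsum_le_of_sum_range_le (fun _ => re_inner_nonneg (isPositive_abs X) _)
    (sum_abs_le_of_contractions e hX hK)

/-- With A = B†B one has UA = (BU†)†B, a product of two operators whose Hilbert–Schmidt sums are at
most that of B, since BU† and its adjoint UB† have equal sums. -/
theorem sum_abs_re_inner_mul_le {A : H →L[ℂ] H} (hA : A.IsPositive)
    (hs : Summable fun n => (inner ℂ (e n) (A (e n))).re) {U : H →L[ℂ] H} (hU : ‖U‖ ≤ 1) (N : ℕ) :
    ∑ n ∈ Finset.range N, |(inner ℂ (e n) ((U * A) (e n))).re| ≤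
      ∑' n, (inner ℂ (e n) (A (e n))).re := by
  obtain ⟨B, rfl⟩ := exists_star_mul_self hA
  simp only [re_inner_star_mul_self] at hs ⊢
  have hBt : ∑' n, ENNReal.ofReal (‖B (e n)‖ ^ 2) = ENNReal.ofReal (∑' n, ‖B (e n)‖ ^ 2) :=
    (ENNReal.ofReal_tsum_of_nonneg (fun n => by positivity) hs).symm
  have h1 : ∑ n ∈ Finset.range N, ‖B (e n)‖ ^ 2 ≤ ∑' n, ‖B (e n)‖ ^ 2 :=
    hs.sum_le_tsum _ fun n _ => by positivity
  have h2 : ∑ n ∈ Finset.range N, ‖(B * star U) (e n)‖ ^ 2 ≤ ∑' n, ‖B (e n)‖ ^ 2 := by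
    rw [← ENNReal.ofReal_le_ofReal_iff (tsum_nonneg fun n => by positivity), ← hBt,
      ENNReal.ofReal_sum_of_nonneg fun n _ => by positivity]
    refine (ENNReal.sum_le_tsum _).trans ?_
    rw [tsum_ofReal_norm_sq_adjoint e (B * star U), tsum_ofReal_norm_sq_adjoint e B]
    refine ENNReal.tsum_le_tsum fun n => ENNReal.ofReal_le_ofReal ?_
    rw [star_mul, star_star, mul_apply_eq_comp]
    refine pow_le_pow_left₀ (norm_nonneg _) ((U.le_opNorm _).trans ?_) 2
    exact mul_le_of_le_one_left (norm_nonneg _) hU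
  have hterm : ∀ n, |(inner ℂ (e n) ((U * (star B * B)) (e n))).re| ≤
      (‖(B * star U) (e n)‖ ^ 2 + ‖B (e n)‖ ^ 2) / 2 := by
    intro n
    have : U * (star B * B) = star (B * star U) * B := by
      rw [star_mul, star_star, mul_assoc]
    rw [this, inner_star_mul]
    exact abs_re_inner_le _ _
  refine (Finset.sum_le_sum fun n _ => hterm n).trans ?_
  rw [← Finset.sum_div, Finset.sum_add_distrib]
  linarith

/-- Without this the trace of |A - B| might be the default value 0, and could not bound anything
from above. -/
theorem summable_abs_sub {A B : H →L[ℂ] H} (hA : A.IsPositive) (hB : B.IsPositive)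
    (hAs : Summable fun n => (inner ℂ (e n) (A (e n))).re)
    (hBs : Summable fun n => (inner ℂ (e n) (B (e n))).re) :
    Summable fun n => (inner ℂ (e n) (CFC.abs (A - B) (e n))).re := by
  refine summable_abs_of_contractions e (hA.isSelfAdjoint.sub hB.isSelfAdjoint)
    (K := (∑' n, (inner ℂ (e n) (A (e n))).re) + ∑' n, (inner ℂ (e n) (B (e n))).re)
    fun U hU N => ?_
  refine le_trans ?_ (add_le_add (sum_abs_re_inner_mul_le e hA hAs hU N)
    (sum_abs_re_inner_mul_le e hB hBs hU N))
  rw [← Finset.sum_add_distrib]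
  refine Finset.sum_le_sum fun n _ => ?_
  rw [mul_sub, sub_apply, inner_sub_right, Complex.sub_re]
  linarith [le_abs_self (inner ℂ (e n) ((U * A) (e n))).re,
    neg_abs_le (inner ℂ (e n) ((U * B) (e n))).re]

/-- |X| ± X is twice the positive or negative part of X, hence a positive operator. -/
theorem abs_re_inner_le_re_inner_abs {X : H →L[ℂ] H} (hX : IsSelfAdjoint X) (x : H) :
    |(inner ℂ x (X x)).re| ≤ (inner ℂ x (CFC.abs X x)).re := by
  have hsub : (CFC.abs X - X).IsPositive := by
    rw [← ContinuousLinearMap.nonneg_iff_isPositive, CFC.abs_sub_self X hX]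
    exact nsmul_nonneg (CFC.negPart_nonneg X) 2
  have hadd : (CFC.abs X + X).IsPositive := by
    rw [← ContinuousLinearMap.nonneg_iff_isPositive, CFC.abs_add_self X hX]
    exact nsmul_nonneg (CFC.posPart_nonneg X) 2
  have h1 := re_inner_nonneg hsub x
  have h2 := re_inner_nonneg hadd x
  rw [sub_apply, inner_sub_right, Complex.sub_re] at h1
  rw [add_apply, inner_add_right, Complex.add_re] at h2
  exact abs_le.2 ⟨by linarith, by linarith⟩

theorem summable_re_inner_of_mem_traceClass {A : H →L[ℂ] H} (hA : A ∈ traceClass e) :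
    Summable fun n => inner ℂ (e n) (A (e n)) := by
  induction hA using Submodule.span_induction with
  | mem A hA =>
    refine (Complex.hasSum_ofReal.2 hA.2.hasSum).summable.congr fun n => ?_
    exact Complex.ext (by simp) (by simp [im_inner_eq_zero hA.1])
  | zero => simp
  | add A B _ _ hA hB => simpa [inner_add_right] using hA.add hB
  | smul c A _ hA => simpa [inner_smul_right] using hA.mul_left c

/-! ### Trace distance against the phase-space distances -/

/-- The Kolmogorov distance of the Q-functions is a lower bound on the trace distance. -/
theorem kolDist_husimiQ_le_traceDist {A B : traceClass e} (hA : (A : H →L[ℂ] H).IsPositive)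
    (hB : (B : H →L[ℂ] H).IsPositive) :
    kolDist (husimiQ e A) (husimiQ e B) ≤ traceDist e A B := by
  have hs := summable_abs_sub e hA hB
    (Complex.hasSum_re (summable_re_inner_of_mem_traceClass e A.2).hasSum).summable
    (Complex.hasSum_re (summable_re_inner_of_mem_traceClass e B.2).hasSum).summable
  have hX : IsSelfAdjoint ((A : H →L[ℂ] H) - B) := hA.isSelfAdjoint.sub hB.isSelfAdjoint
  set X : H →L[ℂ] H := (A : H →L[ℂ] H) - B with hXdef
  have hnn := fun n => re_inner_nonneg (isPositive_abs X) (e n)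
  rw [kolDist, traceDist, re_trace_of_isPositive e (isPositive_abs X)]
  refine mul_le_mul_of_nonneg_left ?_ (by norm_num)
  -- In the non-integrable case the integral is 0 by convention and the bound is trivial.
  by_cases hi : Integrable fun α => |husimiQ e A α - husimiQ e B α|
  swap
  · rw [integral_undef hi]
    exact tsum_nonneg hnn
  rw [← ENNReal.ofReal_le_ofReal_iff (tsum_nonneg hnn),
    ofReal_integral_eq_lintegral_ofReal hi (ae_of_all _ fun α => abs_nonneg _)]
  have hpt : ∀ α, ENNReal.ofReal |husimiQ e A α - husimiQ e B α| ≤ ENNReal.ofReal (1 / Real.pi) *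
      ENNReal.ofReal (inner ℂ (coherent e α) (CFC.abs X (coherent e α))).re := by
    intro α
    rw [← ENNReal.ofReal_mul (by positivity)]
    refine ENNReal.ofReal_le_ofReal ?_
    rw [husimiQ, husimiQ, ← mul_sub, abs_mul, abs_of_pos (by positivity : 0 < 1 / Real.pi),
      ← Complex.sub_re, ← inner_sub_right, ← sub_apply]
    exact mul_le_mul_of_nonneg_left (abs_re_inner_le_re_inner_abs hX _) (by positivity)
  refine (lintegral_mono hpt).trans ?_
  rw [lintegral_const_mul' _ _ ENNReal.ofReal_ne_top]
  refine (mul_le_mul_right (lintegral_re_inner_coherent_le e (isPositive_abs X)) _).trans ?_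
  rw [← mul_assoc, ← ENNReal.ofReal_mul (by positivity), one_div_mul_cancel Real.pi_ne_zero,
    ENNReal.ofReal_one, one_mul, ENNReal.ofReal_tsum_of_nonneg hnn hs]

theorem integrable_smul_rankOne_coherent {P : ℂ → ℝ} (hP : Integrable P) :
    Integrable fun α : ℂ =>
      (P α : ℂ) • InnerProductSpace.rankOne ℂ (coherent e α) (coherent e α) := by
  have hcont : Continuous fun v : H => InnerProductSpace.rankOne ℂ v v := by
    simp only [InnerProductSpace.rankOne_def]
    fun_prop
  refine hP.norm.mono' (hP.ofReal.aestronglyMeasurable.fun_smul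
    (hcont.comp_stronglyMeasurable (stronglyMeasurable_coherent e)).aestronglyMeasurable)
    (ae_of_all _ fun α => ?_)
  rw [norm_smul, InnerProductSpace.norm_rankOne, norm_coherent, Complex.norm_real, mul_one, mul_one]

/-- The trace distance is at most the Kolmogorov distance of the P-functions. -/
theorem traceDist_le_kolDist {A B : traceClass e} {P₁ P₂ : ℂ → ℝ}
    (hA : (A : H →L[ℂ] H).IsPositive) (hB : (B : H →L[ℂ] H).IsPositive)
    (h₁ : IsPFunction e A P₁) (h₂ : IsPFunction e B P₂) :
    traceDist e A B ≤ kolDist P₁ P₂ := by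
  have hX : IsSelfAdjoint ((A : H →L[ℂ] H) - B) := hA.isSelfAdjoint.sub hB.isSelfAdjoint
  have hP : Integrable fun α => P₁ α - P₂ α := h₁.1.sub h₂.1
  have hR := integrable_smul_rankOne_coherent e hP
  have hrep : (A : H →L[ℂ] H) - B = ∫ α : ℂ, ((P₁ α - P₂ α : ℝ) : ℂ) •
      InnerProductSpace.rankOne ℂ (coherent e α) (coherent e α) := by
    rw [h₁.2, h₂.2, ← integral_sub (integrable_smul_rankOne_coherent e h₁.1)
      (integrable_smul_rankOne_coherent e h₂.1)]
    simp only [Complex.ofReal_sub, sub_smul]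
  rw [traceDist, kolDist]
  refine mul_le_mul_of_nonneg_left ?_ (by norm_num)
  refine re_trace_abs_le_of_contractions e hX fun U hU N => ?_
  -- The partial trace of `U T` is a bounded functional of `T`, so it commutes with the Bochner
  -- integral; the full trace is not continuous in operator norm.
  set L : (H →L[ℂ] H) →L[ℂ] ℂ := ∑ n ∈ Finset.range N,
    (innerSL ℂ (e n)) ∘L ((ContinuousLinearMap.apply ℂ H (e n)) ∘L
      (ContinuousLinearMap.mul ℂ (H →L[ℂ] H) U)) with hL
  have hLapp : ∀ T : H →L[ℂ] H,
      (L T).re = ∑ n ∈ Finset.range N, (inner ℂ (e n) ((U * T) (e n))).re := by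
    intro T
    rw [hL, sum_apply, Complex.re_sum]
    rfl
  rw [← hLapp, hrep, ← L.integral_comp_comm hR]
  have hLi := L.integrable_comp hR
  rw [show ∀ z : ℂ, z.re = RCLike.re z from fun _ => rfl, ← integral_re hLi]
  refine integral_mono hLi.re hP.abs fun α => ?_
  exact (hLapp _).trans_le (sum_re_inner_mul_rankOne_le e hU (norm_coherent e α) _ N)

end Operators

end CVSystem

/-! ### The witness and the lower bound -/

theorem mainTheorem4 {H : Type*} [NormedAddCommGroup H] [InnerProductSpace ℂ H] [CompleteSpace H]
    (e : HilbertBasis ℕ ℂ H)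
    (Λ : ℝ → CVSystem.traceClass e →ₗ[ℂ] CVSystem.traceClass e)
    (hΛ : ∀ τ, 0 ≤ τ → CVSystem.IsCPTP e (Λ τ))
    (ρ₁ ρ₂ : CVSystem.traceClass e)
    (hρ₁ : CVSystem.IsDensityOperator e ρ₁) (hρ₂ : CVSystem.IsDensityOperator e ρ₂)
    (s t : ℝ) (hs : 0 ≤ s) (hst : s < t)
    (P₁ P₂ : ℂ → ℝ)
    (hP₁ : CVSystem.IsPFunction e (Λ s ρ₁) P₁) (hP₂ : CVSystem.IsPFunction e (Λ s ρ₂) P₂) :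
    -- the witness
    (CVSystem.kolDist P₁ P₂ <
        CVSystem.kolDist (CVSystem.husimiQ e (Λ t ρ₁)) (CVSystem.husimiQ e (Λ t ρ₂)) →
      (∃ τ ∈ Set.Icc s t, CVSystem.IncreasesAt (CVSystem.evolvedDist e Λ ρ₁ ρ₂) s t τ) ∧
      ¬ CVSystem.IsMarkovian e Λ ∧
      (CVSystem.DifferentiableUpToCountable (CVSystem.evolvedDist e Λ ρ₁ ρ₂) s t →
        ∃ τ ∈ Set.Icc s t, DifferentiableAt ℝ (CVSystem.evolvedDist e Λ ρ₁ ρ₂) τ ∧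
          0 < deriv (CVSystem.evolvedDist e Λ ρ₁ ρ₂) τ)) ∧
    -- the lower bound on the non-Markovianity measure
    (CVSystem.kolDist (CVSystem.husimiQ e (Λ t ρ₁)) (CVSystem.husimiQ e (Λ t ρ₂)) -
          CVSystem.kolDist P₁ P₂ ≤
        CVSystem.evolvedDist e Λ ρ₁ ρ₂ t - CVSystem.evolvedDist e Λ ρ₁ ρ₂ s) ∧
    (CVSystem.DifferentiableUpToCountable (CVSystem.evolvedDist e Λ ρ₁ ρ₂) s t →
      ENNReal.ofReal
          (CVSystem.evolvedDist e Λ ρ₁ ρ₂ t - CVSystem.evolvedDist e Λ ρ₁ ρ₂ s) ≤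
        CVSystem.nonMarkovianity e Λ ρ₁ ρ₂ s t ∧
      ENNReal.ofReal
          (CVSystem.kolDist (CVSystem.husimiQ e (Λ t ρ₁)) (CVSystem.husimiQ e (Λ t ρ₂)) -
            CVSystem.kolDist P₁ P₂) ≤
        CVSystem.nonMarkovianity e Λ ρ₁ ρ₂ s t) := by 
  have hp : ∀ τ, 0 ≤ τ → ∀ {ρ : CVSystem.traceClass e}, (ρ : H →L[ℂ] H).IsPositive →
      (Λ τ ρ : H →L[ℂ] H).IsPositive :=
    fun τ hτ _ hρ => CVSystem.IsCPTP.isPositive e (hΛ τ hτ) hρ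
  have ht := hs.trans hst.le
  have hQ := CVSystem.kolDist_husimiQ_le_traceDist e (hp t ht hρ₁.1) (hp t ht hρ₂.1)
  have hP := CVSystem.traceDist_le_kolDist e (hp s hs hρ₁.1) (hp s hs hρ₂.1) hP₁ hP₂
  have hmain : CVSystem.kolDist (CVSystem.husimiQ e (Λ t ρ₁)) (CVSystem.husimiQ e (Λ t ρ₂)) -
      CVSystem.kolDist P₁ P₂ ≤
        CVSystem.evolvedDist e Λ ρ₁ ρ₂ t - CVSystem.evolvedDist e Λ ρ₁ ρ₂ s :=
    sub_le_sub hQ hP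
  refine ⟨fun hlt => ?_, hmain, fun hD => ?_⟩
  · have hinc : CVSystem.evolvedDist e Λ ρ₁ ρ₂ s < CVSystem.evolvedDist e Λ ρ₁ ρ₂ t := by
      linarith
    exact ⟨CVSystem.exists_increasesAt hst hinc,
      fun hM => not_le.2 hinc (hM ρ₁ ρ₂ hρ₁ hρ₂ hs ht hst.le),
      fun hD => CVSystem.exists_deriv_pos hst hD hinc⟩
  · have h := CVSystem.ofReal_sub_le_lintegral_deriv hst hD
    exact ⟨h, (ENNReal.ofReal_le_ofReal hmain).trans h⟩
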